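/- Let $A$ be a finite-dimensional associative unital algebra over $\mathbb{C}$ with a basis $a_1,\dots,a_n$, and let $d>2$ be even. Write $a_{i_1}\cdots a_{i_d}=\sum_k \mu^k_{i_1,\dots,i_d}\,a_k$ and let $C^A(x)$ be the $n\times\cdots\times n$ ($d$ modes) hypermatrix with entries $C^A(x)_{i_1,\dots,i_d}=\sum_k \mu^k_{i_1,\dots,i_d}\,x_k$. For such a hypermatrix $X$ let $$\mathrm{det}_d(X)=\frac{1}{n!}\sum_{\sigma_1,\dots,\sigma_d\in S_n}\mathrm{sgn}(\sigma_1)\cdots\mathrm{sgn}(\sigma_d)\prod_{i=1}^n X_{\sigma_1(i),\dots,\sigma_d(i)},$$ and let $G=\mathrm{SL}(n,\mathbb{C})^{\times d}$ act on $(\mathbb{C}^n)^{\otimes d}$ by $(g_1,\dots,g_d)\cdot v_1\otimes\cdots\otimes v_d=g_1v_1\otimes\cdots\otimes g_dv_d$. Let $J(A)$ be the Jacobson radical of $A$. 1. With $x_1,\dots,x_n$ formal variables, the polynomial $\det_d(C^A(x))$ is not identically zero if and only if $A$ is semisimple. Equivalently, $J(A)\neq 0$ if and only if $\det_d(C^A(x))\equiv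 0$. 2. If $J(A)\neq 0$, then there is a one-parameter subgroup $\lambda:\mathbb{C}^\times\to G$ (a homomorphism of algebraic groups) such that $\lim_{t\to 0}\lambda(t)\cdot C^A(x)=0$ for every $x\in\mathbb{C}^n$. Hence, for every $x\in\mathbb{C}^n$, the closure of the orbit $G\cdot C^A(x)$ contains $0$, and $C^A(x)$ lies in the null cone, i.e. every homogeneous $G$-invariant polynomial of positive degree on $(\mathbb{C}^n)^{\otimes d}$ vanishes at $C^A(x)$. -/

import Mathlib

open scoped BigOperators

/-- Hypermatrices of format `ι × ⋯ × ι` (`d` modes) with entries in `R`. A tensor in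
`(ℂ^n)^{⊗ d}` is identified with its hypermatrix in the standard basis. -/
abbrev Hypermatrix (d : ℕ) (ι R : Type*) : Type _ := (Fin d → ι) → R

/-- Cayley's combinatorial hyperdeterminant
`det_d(X) = (1/n!) ∑_{σ₁,…,σ_d ∈ S_n} sgn(σ₁)⋯sgn(σ_d) ∏_i X_{σ₁(i),…,σ_d(i)}`,
over any commutative `ℂ`-algebra `R`. -/
noncomputable def hyperdet {d : ℕ} {ι R : Type*} [Fintype ι] [DecidableEq ι]
    [CommRing R] [Algebra ℂ R] (X : Hypermatrix d ι R) : R :=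
  ((Fintype.card ι).factorial : ℂ)⁻¹ •
    ∑ σ : Fin d → Equiv.Perm ι,
      (∏ k, ((Equiv.Perm.sign (σ k) : ℤ) : R)) * ∏ i, X (fun k => σ k i)

/-- The hypermatrix `C^A(x)` of an algebra `A` with basis `(a_i)`: its entry at `(i₁,…,i_d)` is
`∑_k μ^k_{i₁…i_d} x_k`, where `a_{i₁} ⋯ a_{i_d} = ∑_k μ^k_{i₁…i_d} a_k`. The `x_k` may be
complex numbers or the variables of a polynomial ring. -/
noncomputable def algebraTensor {A ι R : Type*} [Ring A] [Algebra ℂ A] [Fintype ι]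
    [CommRing R] [Algebra ℂ R] (d : ℕ) (a : Module.Basis ι ℂ A) (x : ι → R) :
    Hypermatrix d ι R :=
  fun i => ∑ k, algebraMap ℂ R (a.repr (List.ofFn fun l => a (i l)).prod k) * x k

/-- `C^A(x)` with `x` the family of formal variables `(x_k)`. -/
noncomputable def genericAlgebraTensor {A ι : Type*} [Ring A] [Algebra ℂ A] [Fintype ι]
    (d : ℕ) (a : Module.Basis ι ℂ A) : Hypermatrix d ι (MvPolynomial ι ℂ) :=
  algebraTensor d a MvPolynomial.X

/-- The group `SL(n, ℂ)^{× d}`. -/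
abbrev SLPow (d : ℕ) (ι : Type*) [Fintype ι] [DecidableEq ι] : Type _ :=
  Fin d → Matrix.SpecialLinearGroup ι ℂ

/-- The action of `SL(n, ℂ)^{× d}` on `(ℂ^n)^{⊗ d}` extending
`(g₁,…,g_d) · (v₁ ⊗ ⋯ ⊗ v_d) = g₁ v₁ ⊗ ⋯ ⊗ g_d v_d`, in coordinates. -/
noncomputable def slAct {d : ℕ} {ι : Type*} [Fintype ι] [DecidableEq ι]
    (g : SLPow d ι) (X : Hypermatrix d ι ℂ) : Hypermatrix d ι ℂ :=
  fun i => ∑ j : Fin d → ι, (∏ k, (g k).1 (i k) (j k)) * X j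

/-- The orbit of `X` under `SL(n, ℂ)^{× d}`. -/
def slOrbit {d : ℕ} {ι : Type*} [Fintype ι] [DecidableEq ι]
    (X : Hypermatrix d ι ℂ) : Set (Hypermatrix d ι ℂ) :=
  Set.range fun g : SLPow d ι => slAct g X

/-- A one-parameter subgroup of `SL(n, ℂ)^{× d}`: a group homomorphism from `ℂˣ` that is a
morphism of algebraic varieties, i.e. all matrix entries are Laurent polynomials in `t`. -/
def IsOneParameterSubgroup {d : ℕ} {ι : Type*} [Fintype ι] [DecidableEq ι]
    (g : ℂˣ →* SLPow d ι) : Prop :=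
  ∀ (k : Fin d) (i j : ι), ∃ (N : ℕ) (p : Polynomial ℂ),
    ∀ t : ℂˣ, (t : ℂ) ^ N * (g t k).1 i j = p.eval (t : ℂ)

/-- The limit of `g(t) · X` as `t → 0` exists and is `0`. -/
def DegeneratesToZero {d : ℕ} {ι : Type*} [Fintype ι] [DecidableEq ι]
    (g : ℂˣ →* SLPow d ι) (X : Hypermatrix d ι ℂ) : Prop :=
  Filter.Tendsto (fun t : ℂˣ => slAct (g t) X)
    (Filter.comap (fun t : ℂˣ => (t : ℂ)) (nhds 0)) (nhds 0)

/-- Polynomial functions on hypermatrices that are invariant under `SL(n, ℂ)^{× d}`. -/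
def IsSLInvariant {d : ℕ} {ι : Type*} [Fintype ι] [DecidableEq ι]
    (f : MvPolynomial (Fin d → ι) ℂ) : Prop :=
  ∀ (g : SLPow d ι) (X : Hypermatrix d ι ℂ),
    MvPolynomial.eval (slAct g X) f = MvPolynomial.eval X f

/-- The null cone: the common zero set of all homogeneous `SL(n, ℂ)^{× d}`-invariant polynomials
of positive degree. -/
def nullCone (d : ℕ) (ι : Type*) [Fintype ι] [DecidableEq ι] : Set (Hypermatrix d ι ℂ) :=
  {X | ∀ (m : ℕ) (f : MvPolynomial (Fin d → ι) ℂ), 0 < m → f.IsHomogeneous m →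
    IsSLInvariant f → MvPolynomial.eval X f = 0}

/-! In suitable bases both directions become combinatorial.

If $J(A)\ne0$, take a minimal left ideal $V\subseteq J(A)$ and put $K=VA$. Since $J(A)V=0$, $K$ is a
square-zero ideal. By Burnside's theorem $V\otimes A/\mathrm{r.ann}(V)$ embeds in $K$. Comparing
$\dim K$ with the dimensions of $\mathrm{End}(V)$ and $\mathrm{End}(A/\mathrm{r.ann}(V))$ yields a
subspace $L$ with $LK=0$ or $R$ with $KR=0$ of dimension at least $n-\dim K$
(`exists_square_zero_ideal`). A nonzero product has at most one factor in $K$, and none if its first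
factor lies in $L$ (or its last in $R$). Weights of sum zero that penalise these subspaces therefore
give every nonzero product positive total weight, and the resulting one-parameter subgroup contracts
$C^A(x)$ to $0$ for all $x$ at once. Continuous invariants, $\det_d$ among them, then take their
value at $0$.

If $A$ is semisimple, it is a product of matrix algebras. In the basis of matrix units and for the
trace form, the tensor counts closed paths, and its hyperdeterminant is $\frac1{n!}\mathrm{tr}(M^d)$
for a nonzero matrix $M$ with $M^*=\pm M$ (`hyperdet_closedPaths`). For even $d$ this is, up to sign
and the factor $\frac1{n!}$, the squared norm of $M^{d/2}$, hence nonzero. -/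

/-! ### Multilinear action and relative invariance of the hyperdeterminant -/

/-- The action of a family of matrices on a hypermatrix, one matrix for each mode. -/
noncomputable def tensorAct {d : ℕ} {ι : Type*} [Fintype ι]
    (M : Fin d → Matrix ι ι ℂ) (X : Hypermatrix d ι ℂ) : Hypermatrix d ι ℂ :=
  fun i => ∑ j : Fin d → ι, (∏ k, M k (i k) (j k)) * X j

theorem slAct_eq_tensorAct {d : ℕ} {ι : Type*} [Fintype ι] [DecidableEq ι]
    (g : SLPow d ι) (X : Hypermatrix d ι ℂ) : slAct g X = tensorAct (fun k => (g k).1) X := rfl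

theorem tensorAct_tensorAct {d : ℕ} {ι : Type*} [Fintype ι] [DecidableEq ι]
    (M N : Fin d → Matrix ι ι ℂ) (X : Hypermatrix d ι ℂ) :
    tensorAct M (tensorAct N X) = tensorAct (fun k => M k * N k) X := by
  funext i
  simp only [tensorAct, Matrix.mul_apply, Finset.mul_sum, Fintype.prod_sum, Finset.sum_mul,
    Finset.prod_mul_distrib]
  rw [Finset.sum_comm]
  simp only [mul_assoc]

theorem tensorAct_diagonal {d : ℕ} {ι : Type*} [Fintype ι] [DecidableEq ι]
    (w : Fin d → ι → ℂ) (X : Hypermatrix d ι ℂ) (i : Fin d → ι) :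
    tensorAct (fun k => Matrix.diagonal (w k)) X i = (∏ k, w k (i k)) * X i := by
  rw [tensorAct, Finset.sum_eq_single i]
  · simp
  · intro j _ hj
    obtain ⟨k, hk⟩ := Function.ne_iff.mp hj
    rw [Finset.prod_eq_zero (Finset.mem_univ k) (Matrix.diagonal_apply_ne' (w k) hk), zero_mul]
  · simp

theorem continuous_tensorAct {d : ℕ} {ι : Type*} [Fintype ι] (M : Fin d → Matrix ι ι ℂ) :
    Continuous (tensorAct M) := by
  unfold tensorAct
  fun_prop

/-- A determinant is alternating in its columns, so choosing columns by `f` leaves `M.det` times the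
sign of `f`, or zero if `f` is not a permutation. That second factor is kept as a sum so that it is
visibly independent of `M`. -/
theorem sum_sign_mul_prod_submatrix {ι : Type*} [Fintype ι] [DecidableEq ι]
    (M : Matrix ι ι ℂ) (f : ι → ι) :
    ∑ σ : Equiv.Perm ι, ((Equiv.Perm.sign σ : ℤ) : ℂ) * ∏ i, M (σ i) (f i) =
      M.det * ∑ σ : Equiv.Perm ι,
        if f = σ then ((Equiv.Perm.sign σ : ℤ) : ℂ) else 0 := by
  have h : ∑ σ : Equiv.Perm ι, ((Equiv.Perm.sign σ : ℤ) : ℂ) * ∏ i, M (σ i) (f i) =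
      (M.submatrix id f).det := by
    rw [Matrix.det_apply']; rfl
  rw [h]
  by_cases hf : Function.Injective f
  · let τ : Equiv.Perm ι := Equiv.ofBijective f (Finite.injective_iff_bijective.mp hf)
    have hτ : ∀ σ : Equiv.Perm ι, f = σ ↔ τ = σ := fun σ => by
      rw [Equiv.ext_iff, funext_iff]; rfl
    simp only [hτ]
    rw [Finset.sum_ite_eq, if_pos (Finset.mem_univ _), mul_comm]
    exact Matrix.det_permute' τ M
  · rw [Finset.sum_eq_zero, mul_zero]
    · obtain ⟨i, j, hij, hne⟩ := Function.not_injective_iff.mp hf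
      exact Matrix.det_zero_of_column_eq hne fun k => by simp [hij]
    · intro σ _
      rw [if_neg]
      rintro rfl
      exact hf σ.injective

theorem hyperdet_tensorAct {d : ℕ} {ι : Type*} [Fintype ι] [DecidableEq ι]
    (M : Fin d → Matrix ι ι ℂ) (X : Hypermatrix d ι ℂ) :
    hyperdet (tensorAct M X) = (∏ k, (M k).det) * hyperdet X := by
  have expand : ∀ N : Fin d → Matrix ι ι ℂ, hyperdet (tensorAct N X) =
      ((Fintype.card ι).factorial : ℂ)⁻¹ • ∑ J : ι → Fin d → ι,
        (∏ k, ((N k).det * ∑ σ : Equiv.Perm ι,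
          if (fun i => J i k) = σ then ((Equiv.Perm.sign σ : ℤ) : ℂ) else 0)) *
          ∏ i, X (J i) := by
    intro N
    simp only [hyperdet, tensorAct, ← sum_sign_mul_prod_submatrix]
    congr 1
    simp only [Fintype.prod_sum, Finset.mul_sum, Finset.sum_mul, Finset.prod_mul_distrib]
    rw [Finset.sum_comm]
    refine Finset.sum_congr rfl fun J _ => Finset.sum_congr rfl fun σ _ => ?_
    rw [Finset.prod_comm (f := fun i k => N k (σ k i) (J i k))]
    ring
  have one : tensorAct (fun _ => (1 : Matrix ι ι ℂ)) X = X := by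
    funext i
    simpa using tensorAct_diagonal (fun _ _ => (1 : ℂ)) X i
  -- The factor that remains after the determinants are removed is the expansion for identity
  -- matrices, that is, `hyperdet X` itself.
  have h1 := expand fun _ => 1
  rw [one] at h1
  rw [expand, h1]
  simp only [Matrix.det_one, one_mul, Finset.prod_mul_distrib, mul_assoc]
  rw [← Finset.mul_sum, mul_smul_comm]

theorem hyperdet_slAct {d : ℕ} {ι : Type*} [Fintype ι] [DecidableEq ι]
    (g : SLPow d ι) (X : Hypermatrix d ι ℂ) : hyperdet (slAct g X) = hyperdet X := by
  simp [slAct_eq_tensorAct, hyperdet_tensorAct]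

theorem continuous_hyperdet {d : ℕ} {ι : Type*} [Fintype ι] [DecidableEq ι] :
    Continuous (hyperdet : Hypermatrix d ι ℂ → ℂ) := by
  unfold hyperdet
  fun_prop

/-- For an empty index set the empty product would give the value 1. -/
theorem hyperdet_zero {d : ℕ} {ι : Type*} [Fintype ι] [DecidableEq ι] [Nonempty ι] :
    hyperdet (0 : Hypermatrix d ι ℂ) = 0 := by
  simp [hyperdet]

theorem map_hyperdet {d : ℕ} {ι R S : Type*} [Fintype ι] [DecidableEq ι]
    [CommRing R] [Algebra ℂ R] [CommRing S] [Algebra ℂ S] (f : R →ₐ[ℂ] S)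
    (X : Hypermatrix d ι R) : f (hyperdet X) = hyperdet fun i => f (X i) := by
  simp [hyperdet]

/-! ### Product tensors and change of basis -/

/-- The hypermatrix of the multilinear form `l (b₁ ⋯ b_d)` with respect to a family of vectors
for each mode. -/
noncomputable def productTensor {A ι : Type*} [Ring A] [Algebra ℂ A] {d : ℕ}
    (l : A →ₗ[ℂ] ℂ) (b : Fin d → ι → A) : Hypermatrix d ι ℂ :=
  fun i => l (List.ofFn fun k => b k (i k)).prod

theorem algebraTensor_eq_productTensor {A ι : Type*} [Ring A] [Algebra ℂ A] [Fintype ι]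
    (d : ℕ) (a : Module.Basis ι ℂ A) (x : ι → ℂ) :
    algebraTensor d a x = productTensor (a.constr ℂ x) fun _ => a := by
  funext i
  simp [algebraTensor, productTensor, Module.Basis.constr_apply_fintype]

theorem productTensor_constr {A ι : Type*} [Ring A] [Algebra ℂ A] [Fintype ι]
    {d : ℕ} (l : A →ₗ[ℂ] ℂ) (M : Fin d → Matrix ι ι ℂ) (b : Fin d → ι → A) :
    productTensor l (fun k i => ∑ j, M k i j • b k j) = tensorAct M (productTensor l b) := by
  funext i
  have h := ((MultilinearMap.mkPiAlgebraFin ℂ d A).map_sum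
    fun (k : Fin d) (j : ι) => M k (i k) j • b k j)
  simp only [MultilinearMap.map_smul_univ] at h
  simp only [MultilinearMap.mkPiAlgebraFin_apply] at h
  simp only [productTensor, tensorAct, h, map_sum, map_smul, smul_eq_mul]

theorem productTensor_eq_tensorAct_toMatrix {A ι : Type*} [Ring A] [Algebra ℂ A] [Fintype ι]
    {d : ℕ} (l : A →ₗ[ℂ] ℂ) (b c : Fin d → Module.Basis ι ℂ A) :
    productTensor l (fun k => b k) =
      tensorAct (fun k => ((c k).toMatrix (b k)).transpose) (productTensor l fun k => c k) := by
  rw [← productTensor_constr]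
  congr 1
  funext k i
  exact ((c k).sum_toMatrix_smul_self (b k) i).symm

theorem eval_hyperdet_genericAlgebraTensor {A ι : Type*} [Ring A] [Algebra ℂ A] [Fintype ι]
    [DecidableEq ι] (d : ℕ) (a : Module.Basis ι ℂ A) (x : ι → ℂ) :
    MvPolynomial.eval x (hyperdet (genericAlgebraTensor d a)) =
      hyperdet (algebraTensor d a x) := by
  change MvPolynomial.aeval (R := ℂ) x _ = _
  rw [genericAlgebraTensor, map_hyperdet]
  congr 1
  funext i
  simp [algebraTensor, MvPolynomial.algebraMap_eq, map_sum]

theorem hyperdet_genericAlgebraTensor_eq_zero_iff {A ι : Type*} [Ring A] [Algebra ℂ A]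
    [Fintype ι] [DecidableEq ι] (d : ℕ) (a : Module.Basis ι ℂ A) :
    hyperdet (genericAlgebraTensor d a) = 0 ↔
      ∀ x : ι → ℂ, hyperdet (algebraTensor d a x) = 0 := by
  simp only [← eval_hyperdet_genericAlgebraTensor]
  exact ⟨fun h x => by simp [h], fun h => MvPolynomial.funext fun x => by simp [h]⟩

/-! ### Diagonal one-parameter subgroups -/

theorem prod_zpow_eq_zpow_sum {G κ : Type*} [CommGroup G] (s : Finset κ) (w : κ → ℤ) (t : G) :
    ∏ i ∈ s, t ^ w i = t ^ ∑ i ∈ s, w i := by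
  classical
  induction s using Finset.induction_on with
  | empty => simp
  | insert i s hi ih => rw [Finset.prod_insert hi, Finset.sum_insert hi, ih, zpow_add]

/-- The one-parameter subgroup `t ↦ Q · diag(t ^ w) · Q⁻¹` of `SL`. -/
noncomputable def conjDiagonal {ι : Type*} [Fintype ι] [DecidableEq ι] (Q R : Matrix ι ι ℂ)
    (hQR : Q * R = 1) (w : ι → ℤ) (hw : ∑ i, w i = 0) :
    ℂˣ →* Matrix.SpecialLinearGroup ι ℂ :=
  MonoidHom.mk' (fun t => ⟨Q * Matrix.diagonal (fun i => ((t ^ w i : ℂˣ) : ℂ)) * R, by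
      have h : ∏ i, ((t ^ w i : ℂˣ) : ℂ) = 1 := by
        rw [← Units.coe_prod, prod_zpow_eq_zpow_sum, hw]; simp
      rw [Matrix.det_mul, Matrix.det_mul, Matrix.det_diagonal, h, mul_one,
        ← Matrix.det_mul, hQR, Matrix.det_one]⟩) <| by
    intro s t
    apply Subtype.ext
    have hRQ := mul_eq_one_comm.mp hQR
    calc Q * Matrix.diagonal (fun i => (((s * t) ^ w i : ℂˣ) : ℂ)) * R
        = Q * (Matrix.diagonal (fun i => ((s ^ w i : ℂˣ) : ℂ)) * (R * Q) *
            Matrix.diagonal (fun i => ((t ^ w i : ℂˣ) : ℂ))) * R := by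
          rw [hRQ, mul_one, Matrix.diagonal_mul_diagonal]
          simp [mul_zpow]
      _ = Q * Matrix.diagonal (fun i => ((s ^ w i : ℂˣ) : ℂ)) * R *
            (Q * Matrix.diagonal (fun i => ((t ^ w i : ℂˣ) : ℂ)) * R) := by
          simp only [mul_assoc]

theorem coe_conjDiagonal {ι : Type*} [Fintype ι] [DecidableEq ι] (Q R : Matrix ι ι ℂ)
    (hQR : Q * R = 1) (w : ι → ℤ) (hw : ∑ i, w i = 0) (t : ℂˣ) :
    (conjDiagonal Q R hQR w hw t).1 =
      Q * Matrix.diagonal (fun i => ((t ^ w i : ℂˣ) : ℂ)) * R := rfl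

/-- In the bases `c k` the subgroup is diagonal and scales the entry at `j` by $t$ to the total
weight of `j`; an entry survives only where the product of basis vectors is nonzero, and there the
weight is positive. Each mode may have its own basis because the factors of the group are
independent. Bases and weights do not involve `x`, so one subgroup serves all `x`. -/
theorem exists_oneParameterSubgroup_degeneratesToZero {A ι : Type*} [Ring A] [Algebra ℂ A]
    [Fintype ι] [DecidableEq ι] {d : ℕ} (a : Module.Basis ι ℂ A)
    (c : Fin d → Module.Basis ι ℂ A) (w : Fin d → ι → ℤ) (hw : ∀ k, ∑ i, w k i = 0)
    (hpos : ∀ j : Fin d → ι, (List.ofFn fun k => c k (j k)).prod ≠ 0 → 0 < ∑ k, w k (j k)) :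
    ∃ g : ℂˣ →* SLPow d ι, IsOneParameterSubgroup g ∧
      ∀ x : ι → ℂ, DegeneratesToZero g (algebraTensor d a x) := by
  let Q : Fin d → Matrix ι ι ℂ := fun k => ((c k).toMatrix a).transpose
  let R : Fin d → Matrix ι ι ℂ := fun k => (a.toMatrix (c k)).transpose
  have hQR : ∀ k, Q k * R k = 1 := fun k => by
    simp only [Q, R]
    rw [← Matrix.transpose_mul, Module.Basis.toMatrix_mul_toMatrix_flip, Matrix.transpose_one]
  refine ⟨MonoidHom.pi fun k => conjDiagonal (Q k) (R k) (hQR k) (w k) (hw k), ?_, ?_⟩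
  · intro k i j
    -- This exponent dominates every `|w k l|`, so it clears all poles at once.
    let N : ℕ := ∑ l, (w k l).natAbs
    have hN : ∀ l, 0 ≤ (N : ℤ) + w k l := fun l => by
      have : (w k l).natAbs ≤ N :=
        Finset.single_le_sum (f := fun l => (w k l).natAbs) (fun _ _ => Nat.zero_le _)
          (Finset.mem_univ l)
      omega
    refine ⟨N, ∑ l, Polynomial.C (Q k i l * R k l j) * Polynomial.X ^ ((N : ℤ) + w k l).toNat, ?_⟩
    intro t
    change (t : ℂ) ^ N * (conjDiagonal (Q k) (R k) (hQR k) (w k) (hw k) t).1 i j = _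
    rw [coe_conjDiagonal]
    rw [Matrix.mul_apply]
    simp only [Matrix.mul_diagonal, Polynomial.eval_finsetSum,
      Polynomial.eval_mul, Polynomial.eval_C, Polynomial.eval_pow, Polynomial.eval_X,
      Finset.mul_sum]
    refine Finset.sum_congr rfl fun l _ => ?_
    have : (t : ℂ) ^ ((N : ℤ) + w k l).toNat = (t : ℂ) ^ N * ((t ^ w k l : ℂˣ) : ℂ) := by
      rw [← zpow_natCast, Int.toNat_of_nonneg (hN l), zpow_add₀ t.ne_zero, zpow_natCast,
        Units.val_zpow_eq_zpow_val]
    rw [this]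
    ring
  · intro x
    let Y : Hypermatrix d ι ℂ := productTensor (a.constr ℂ x) fun k => c k
    have act : ∀ t : ℂˣ, slAct (fun k => conjDiagonal (Q k) (R k) (hQR k) (w k) (hw k) t)
        (algebraTensor d a x) =
        tensorAct Q (fun i => (∏ k, ((t ^ w k (i k) : ℂˣ) : ℂ)) * Y i) := fun t => by
      have hY : Y = tensorAct R (algebraTensor d a x) := by
        rw [algebraTensor_eq_productTensor]
        exact productTensor_eq_tensorAct_toMatrix _ c fun _ => a
      have hD : (fun i => (∏ k, ((t ^ w k (i k) : ℂˣ) : ℂ)) * Y i) =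
          tensorAct (fun k => Matrix.diagonal fun i => ((t ^ w k i : ℂˣ) : ℂ)) Y :=
        funext fun i => (tensorAct_diagonal (fun k i => ((t ^ w k i : ℂˣ) : ℂ)) Y i).symm
      rw [hD, hY, tensorAct_tensorAct, tensorAct_tensorAct, slAct_eq_tensorAct]
      exact congrArg (tensorAct · _) (funext fun k => by rw [coe_conjDiagonal, mul_assoc])
    have lim : Filter.Tendsto (fun (t : ℂˣ) (i : Fin d → ι) =>
        (∏ k, ((t ^ w k (i k) : ℂˣ) : ℂ)) * Y i)
        (Filter.comap (fun t : ℂˣ => (t : ℂ)) (nhds 0)) (nhds 0) := by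
      rw [tendsto_pi_nhds]
      intro i
      by_cases hi : (List.ofFn fun k => c k (i k)).prod = 0
      · have : Y i = 0 := by simp only [Y, productTensor, hi, map_zero]
        simpa [this] using tendsto_const_nhds
      · have hp := hpos i hi
        have ht : ∀ t : ℂˣ, (∏ k, ((t ^ w k (i k) : ℂˣ) : ℂ)) =
            (t : ℂ) ^ (∑ k, w k (i k)).toNat := fun t => by
          rw [← Units.coe_prod, prod_zpow_eq_zpow_sum, ← zpow_natCast,
            Int.toNat_of_nonneg hp.le, Units.val_zpow_eq_zpow_val]
        simp only [ht]
        have h0 : (0 : ℂ) ^ (∑ k, w k (i k)).toNat * Y i = 0 := by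
          rw [zero_pow (by omega), zero_mul]
        have hc : Continuous fun z : ℂ => z ^ (∑ k, w k (i k)).toNat * Y i := by fun_prop
        have := (hc.tendsto 0).comp (Filter.tendsto_comap (f := fun t : ℂˣ => (t : ℂ)))
        rw [h0] at this
        exact this
    have h0 : tensorAct Q (0 : Hypermatrix d ι ℂ) = 0 := by
      funext i; simp [tensorAct]
    have := ((continuous_tensorAct Q).tendsto 0).comp lim
    rw [h0] at this
    refine this.congr fun t => ?_
    exact (act t).symm

/-! ### Orbit closures and the null cone -/

theorem neBot_comap_units_nhds_zero :
    (Filter.comap (fun t : ℂˣ => (t : ℂ)) (nhds 0)).NeBot := by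
  rw [Filter.comap_neBot_iff]
  intro s hs
  have : (nhdsWithin (0 : ℂ) {0}ᶜ).NeBot := inferInstance
  obtain ⟨z, hz, hz0⟩ := Filter.nonempty_of_mem
    (Filter.inter_mem (mem_nhdsWithin_of_mem_nhds (a := (0 : ℂ)) (s := s) (t := {0}ᶜ) hs) self_mem_nhdsWithin)
  exact ⟨Units.mk0 z hz0, hz⟩

section Degeneration
variable {d : ℕ} {ι : Type*} [Fintype ι] [DecidableEq ι] {g : ℂˣ →* SLPow d ι}
  {X : Hypermatrix d ι ℂ}

theorem DegeneratesToZero.zero_mem_closure_slOrbit (h : DegeneratesToZero g X) :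
    (0 : Hypermatrix d ι ℂ) ∈ closure (slOrbit X) :=
  have := neBot_comap_units_nhds_zero
  mem_closure_of_tendsto h (Filter.Eventually.of_forall fun t => ⟨g t, rfl⟩)

theorem eq_of_zero_mem_closure_slOrbit {f : Hypermatrix d ι ℂ → ℂ} (hf : Continuous f)
    (hinv : ∀ (g : SLPow d ι) (X : Hypermatrix d ι ℂ), f (slAct g X) = f X)
    (h : (0 : Hypermatrix d ι ℂ) ∈ closure (slOrbit X)) : f X = f 0 := by
  have hcl : IsClosed {Y | f Y = f X} := isClosed_eq hf continuous_const
  refine (closure_minimal ?_ hcl h).symm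
  rintro _ ⟨g, rfl⟩
  exact hinv g X

theorem mem_nullCone_of_zero_mem_closure_slOrbit
    (h : (0 : Hypermatrix d ι ℂ) ∈ closure (slOrbit X)) : X ∈ nullCone d ι := by
  intro m f hm hf hinv
  rw [eq_of_zero_mem_closure_slOrbit (MvPolynomial.continuous_eval f) hinv h]
  change MvPolynomial.eval 0 f = 0
  rw [MvPolynomial.eval_zero, MvPolynomial.constantCoeff_eq]
  exact hf.coeff_eq_zero (by simpa using hm.ne)

theorem hyperdet_eq_zero_of_zero_mem_closure_slOrbit [Nonempty ι]
    (h : (0 : Hypermatrix d ι ℂ) ∈ closure (slOrbit X)) : hyperdet X = 0 := by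
  rw [eq_of_zero_mem_closure_slOrbit continuous_hyperdet hyperdet_slAct h, hyperdet_zero]

end Degeneration

/-! ### A square-zero ideal with a large annihilator -/

/-- A basis, with prescribed index type, some of whose members form a basis of a subspace. -/
theorem exists_basis_mem_submodule {A ι : Type*} [AddCommGroup A] [Module ℂ A] [Fintype ι]
    (a : Module.Basis ι ℂ A) (U : Submodule ℂ A) :
    ∃ (c : Module.Basis ι ℂ A) (S : Finset ι), S.card = Module.finrank ℂ U ∧
      ∀ i ∈ S, c i ∈ U := by
  classical
  have : FiniteDimensional ℂ A := a.finiteDimensional_of_finite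
  obtain ⟨U', hU⟩ := U.exists_isCompl
  let b := ((Module.finBasis ℂ U).prod (Module.finBasis ℂ U')).map
    (Submodule.prodEquivOfIsCompl U U' hU)
  let e : _ ≃ ι := b.indexEquiv a
  refine ⟨b.reindex e, Finset.univ.image fun i => e (Sum.inl i), ?_, ?_⟩
  · have he : Function.Injective fun i => e (Sum.inl i) := e.injective.comp Sum.inl_injective
    rw [Finset.card_image_of_injective _ he]
    simp
  · intro i hi
    obtain ⟨j, -, rfl⟩ := Finset.mem_image.mp hi
    simp [b]

/-- Burnside's theorem: a simple module over a complex algebra has all linear endomorphisms. -/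
theorem IsSimpleModule.exists_smul_eq {A V : Type*} [Ring A] [Algebra ℂ A] [AddCommGroup V]
    [Module A V] [Module ℂ V] [IsScalarTower ℂ A V] [FiniteDimensional ℂ V] [IsSimpleModule A V]
    (f : V →ₗ[ℂ] V) : ∃ r : A, ∀ v, f v = r • v := by
  have hs := IsSimpleModule.algebraMap_end_bijective_of_isAlgClosed (A := A) (V := V) ℂ
  have : Module.Finite (Module.End A V) V :=
    Module.Finite.of_restrictScalars_finite ℂ (Module.End A V) V
  -- By Schur's lemma the `A`-endomorphisms of `V` are scalars, so `f` commutes with all of them and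
  -- the density theorem applies.
  let F : Module.End (Module.End A V) V :=
    { toFun := f
      map_add' := f.map_add
      map_smul' := fun φ v => by
        obtain ⟨z, rfl⟩ := hs.2 φ
        simp }
  obtain ⟨r, hr⟩ := Module.Finite.toModuleEnd_moduleEnd_surjective (R := A) (M := V) F
  exact ⟨r, fun v => (LinearMap.congr_fun hr v).symm⟩

section SimpleLeftIdeal
variable {A V : Type*} [Ring A] [Algebra ℂ A] [AddCommGroup V] [Module A V]

/-- The elements annihilated by left multiplication with the range of a linear map into the
algebra. -/
def rightAnnihilator (f : V →ₗ[A] A) : Submodule ℂ A where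
  carrier := {b | ∀ v, f v * b = 0}
  add_mem' hx hy v := by rw [mul_add, hx v, hy v, add_zero]
  zero_mem' v := mul_zero _
  smul_mem' z x hx v := by rw [mul_smul_comm, hx v, smul_zero]

theorem mem_rightAnnihilator {f : V →ₗ[A] A} {b : A} :
    b ∈ rightAnnihilator f ↔ ∀ v, f v * b = 0 := Iff.rfl

/-- The action of the algebra on the quotient by a right annihilator by right multiplication. -/
noncomputable def rightMulQuotient (f : V →ₗ[A] A) :
    A →ₗ[ℂ] Module.End ℂ (A ⧸ rightAnnihilator f) where
  toFun x := (rightAnnihilator f).mapQ (rightAnnihilator f) (LinearMap.mulRight ℂ x)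
    fun b hb v => by rw [LinearMap.mulRight_apply, ← mul_assoc, hb v, zero_mul]
  map_add' x y := Submodule.linearMap_qext _ <| LinearMap.ext fun b =>
    congrArg (Submodule.Quotient.mk (p := rightAnnihilator f)) (mul_add b x y)
  map_smul' z x := Submodule.linearMap_qext _ <| LinearMap.ext fun b =>
    congrArg (Submodule.Quotient.mk (p := rightAnnihilator f)) (mul_smul_comm z b x)

theorem mem_ker_rightMulQuotient {f : V →ₗ[A] A} {x : A}
    (hx : x ∈ LinearMap.ker (rightMulQuotient f)) (v : V) (b : A) : f v * b * x = 0 := by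
  have h : Submodule.Quotient.mk (p := rightAnnihilator f) (b * x) = 0 :=
    LinearMap.congr_fun (LinearMap.mem_ker.mp hx) (Submodule.Quotient.mk b)
  rw [mul_assoc]
  exact mem_rightAnnihilator.mp ((Submodule.Quotient.mk_eq_zero _).mp h) v

variable [FiniteDimensional ℂ A]

theorem finrank_le_sq_add_finrank_ker {W : Type*} [AddCommGroup W] [Module ℂ W]
    [FiniteDimensional ℂ W] (f : A →ₗ[ℂ] Module.End ℂ W) :
    Module.finrank ℂ A ≤
      Module.finrank ℂ W * Module.finrank ℂ W + Module.finrank ℂ (LinearMap.ker f) := by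
  rw [← LinearMap.finrank_range_add_finrank_ker f]
  exact Nat.add_le_add_right ((LinearMap.range f).finrank_le.trans_eq
    (Module.finrank_linearMap ℂ ℂ W W)) _

/-- For a linear map `f` from a simple module `V` to a complex algebra, the tensor product of `V`
with the quotient by the right annihilator embeds into the two-sided ideal generated by the
range. -/
theorem finrank_mul_finrank_quotient_rightAnnihilator_le [Module ℂ V]
    [IsScalarTower ℂ A V] [FiniteDimensional ℂ V] [IsSimpleModule A V] (f : V →ₗ[A] A) :
    Module.finrank ℂ V * Module.finrank ℂ (A ⧸ rightAnnihilator f) ≤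
      Module.finrank ℂ ((LinearMap.range f).restrictScalars ℂ * ⊤ : Submodule ℂ A) := by
  let v := Module.finBasis ℂ V
  let φ := Module.finBasis ℂ (A ⧸ rightAnnihilator f)
  choose b hb using fun j => Submodule.Quotient.mk_surjective (rightAnnihilator f) (φ j)
  have mem : ∀ p : Fin _ × Fin _,
      f (v p.1) * b p.2 ∈ (LinearMap.range f).restrictScalars ℂ * (⊤ : Submodule ℂ A) :=
    fun p => Submodule.mul_mem_mul ⟨v p.1, rfl⟩ trivial
  have ind : LinearIndependent ℂ fun p : Fin _ × Fin _ => f (v p.1) * b p.2 := by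
    rw [Fintype.linearIndependent_iff]
    intro c hc
    have key : ∀ i, ∑ j, c (i, j) • φ j = 0 := by
      intro i
      have : ∑ j, c (i, j) • b j ∈ rightAnnihilator f := fun w => by
        -- Multiplying the relation by an `r` that acts as the rank-one operator
        -- $v_k\mapsto\delta_{ik}w$ isolates its `i`-th row.
        obtain ⟨r, hr⟩ := IsSimpleModule.exists_smul_eq (A := A) ((v.coord i).smulRight w)
        have h := congrArg (r * ·) hc
        have hf : ∀ k y, r * (f (v k) * y) = f ((v.coord i).smulRight w (v k)) * y := by
          intro k y
          rw [hr, map_smul, smul_eq_mul, mul_assoc]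
        simp only [Finset.mul_sum, mul_smul_comm, mul_zero, hf] at h
        rw [Fintype.sum_prod_type, Finset.sum_eq_single i] at h
        · simpa [Finset.mul_sum] using h
        · intro k _ hk
          simp [Finsupp.single_eq_of_ne hk.symm]
        · simp
      have h := (Submodule.Quotient.mk_eq_zero _).mpr this
      rw [← Submodule.mkQ_apply, map_sum] at h
      simpa [hb] using h
    rintro ⟨i, j⟩
    exact Fintype.linearIndependent_iff.mp φ.linearIndependent _ (key i) j
  have ind' : LinearIndependent ℂ fun p : Fin _ × Fin _ =>
      (⟨_, mem p⟩ : ((LinearMap.range f).restrictScalars ℂ * ⊤ : Submodule ℂ A)) :=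
    LinearIndependent.of_comp (Submodule.subtype _) ind
  simpa using ind'.fintype_card_le_finrank

/-- A finite-dimensional complex algebra that is not semisimple has a nonzero square-zero
two-sided ideal whose left or right annihilator is large. -/
theorem exists_square_zero_ideal (hJ : Ring.jacobson A ≠ ⊥) :
    ∃ K L R : Submodule ℂ A, 0 < Module.finrank ℂ K ∧
      (∀ x ∈ K, ∀ y, x * y ∈ K) ∧ (∀ x ∈ K, ∀ y, y * x ∈ K) ∧
      (∀ x ∈ K, ∀ y ∈ K, x * y = 0) ∧
      (∀ x ∈ L, ∀ y ∈ K, x * y = 0) ∧ (∀ x ∈ R, ∀ y ∈ K, y * x = 0) ∧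
      (Module.finrank ℂ A ≤ Module.finrank ℂ K + Module.finrank ℂ L ∨
        Module.finrank ℂ A ≤ Module.finrank ℂ K + Module.finrank ℂ R) := by
  have : IsArtinianRing A := IsArtinianRing.of_finite ℂ A
  obtain ⟨V, hV, hVJ⟩ := (eq_bot_or_exists_atom_le (Ring.jacobson A)).resolve_left hJ
  have : IsSimpleModule A V := isSimpleModule_iff_isAtom.mpr hV
  have : FiniteDimensional ℂ V := inferInstanceAs (FiniteDimensional ℂ (V.restrictScalars ℂ))
  have hJV : ∀ x ∈ Ring.jacobson A, ∀ v ∈ V, x * v = 0 := fun x hx v hv =>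
    congrArg Subtype.val (Module.mem_annihilator.mp
      (IsSemisimpleModule.jacobson_le_annihilator A V hx) ⟨v, hv⟩)
  have left : ∀ x : A, (∀ v ∈ V, x * v = 0) →
      ∀ y ∈ V.restrictScalars ℂ * (⊤ : Submodule ℂ A), x * y = 0 := by
    intro x hx y hy
    induction hy using Submodule.mul_induction_on' with
    | mem_mul_mem v hv b _ => rw [← mul_assoc, hx v hv, zero_mul]
    | add y _ z _ hy hz => rw [mul_add, hy, hz, add_zero]
  -- The ideal is $K=VA$; `L` is the kernel of the left action on `V`, and `R` the kernel of the
  -- right action on $A/\mathrm{r.ann}(V)$.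
  refine ⟨V.restrictScalars ℂ * ⊤, LinearMap.ker (Algebra.lsmul ℂ ℂ V).toLinearMap,
    LinearMap.ker (rightMulQuotient V.subtype), ?_, ?_, ?_, ?_, ?_, ?_, ?_⟩
  · rw [Module.finrank_pos_iff_exists_ne_zero]
    obtain ⟨v, hv, hv0⟩ := V.ne_bot_iff.mp hV.1
    refine ⟨⟨v, ?_⟩, fun h => hv0 (congrArg Subtype.val h)⟩
    simpa using Submodule.mul_mem_mul (M := V.restrictScalars ℂ) (N := ⊤) hv
      (Submodule.mem_top (x := (1 : A)))
  · intro x hx y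
    have := Submodule.mul_mem_mul hx (Submodule.mem_top (R := ℂ) (x := y))
    rw [mul_assoc] at this
    exact (mul_le_mul' le_rfl le_top :
      V.restrictScalars ℂ * (⊤ * ⊤ : Submodule ℂ A) ≤ V.restrictScalars ℂ * ⊤) this
  · intro x hx y
    induction hx using Submodule.mul_induction_on' with
    | mem_mul_mem v hv b hb =>
      rw [← mul_assoc]
      exact Submodule.mul_mem_mul (V.smul_mem y hv) hb
    | add x _ z _ hx hz => rw [mul_add]; exact add_mem hx hz
  · intro x hx
    -- $K$ lies in the radical, which kills `V` and hence $VA=K$.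
    refine left x fun v hv => hJV x ?_ v hv
    induction hx using Submodule.mul_induction_on' with
    | mem_mul_mem v hv b _ => exact Ideal.mul_mem_right _ _ (hVJ hv)
    | add x _ z _ hx hz => exact add_mem hx hz
  · intro x hx
    exact left x fun v hv => congrArg Subtype.val
      (LinearMap.congr_fun (LinearMap.mem_ker.mp hx) ⟨v, hv⟩)
  · intro x hx y hy
    induction hy using Submodule.mul_induction_on' with
    | mem_mul_mem v hv b _ =>
      exact mem_ker_rightMulQuotient hx ⟨v, hv⟩ b
    | add y _ z _ hy hz => rw [add_mul, hy, hz, add_zero]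
  · have h1 := finrank_mul_finrank_quotient_rightAnnihilator_le V.subtype
    rw [Submodule.range_subtype] at h1
    have h2 := finrank_le_sq_add_finrank_ker (Algebra.lsmul ℂ ℂ V).toLinearMap (A := A)
    have h3 := finrank_le_sq_add_finrank_ker (rightMulQuotient V.subtype)
    -- With $v=\dim V$ and $q=\dim A/\mathrm{r.ann}(V)$: $vq\le\dim K$, $n\le v^2+\dim L$ and $n\le
    -- q^2+\dim R$. The smaller of $v^2,q^2$ is at most $vq$.
    rcases le_total (Module.finrank ℂ V) (Module.finrank ℂ (A ⧸ rightAnnihilator V.subtype))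
      with h | h
    · exact Or.inl (h2.trans (Nat.add_le_add_right ((Nat.mul_le_mul_left _ h).trans h1) _))
    · exact Or.inr (h3.trans (Nat.add_le_add_right ((Nat.mul_le_mul_right _ h).trans h1) _))

end SimpleLeftIdeal

/-! ### Weights and the contracting subgroup -/

/-- One factor in `K` puts the whole product in `K`; a second one would make it a multiple of a
product of two elements of `K`, which is zero. -/
theorem prod_ofFn_mem_of_square_zero_ideal {A : Type*} [Ring A] [Algebra ℂ A] {K : Submodule ℂ A}
    (hr : ∀ x ∈ K, ∀ y, x * y ∈ K) (hl : ∀ x ∈ K, ∀ y, y * x ∈ K)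
    (hK : ∀ x ∈ K, ∀ y ∈ K, x * y = 0) {e : ℕ} (f : Fin e → A) (p : Fin e → Prop)
    [DecidablePred p] (hp : ∀ k, p k → f k ∈ K) (hf : (List.ofFn f).prod ≠ 0) :
    (∑ k, if p k then 1 else 0) ≤ 1 ∧
      (0 < (∑ k, if p k then 1 else 0) → (List.ofFn f).prod ∈ K) := by
  induction e with
  | zero => simp
  | succ e ih =>
    rw [List.ofFn_succ, List.prod_cons] at hf ⊢
    rw [Fin.sum_univ_succ]
    obtain ⟨h1, h2⟩ := ih (fun k => f k.succ) (fun k => p k.succ) (fun k => hp k.succ)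
      (right_ne_zero_of_mul hf)
    by_cases h0 : p 0
    · have hs : ¬ 0 < ∑ k : Fin e, if p k.succ then 1 else 0 := fun hs =>
        hf (hK _ (hp 0 h0) _ (h2 hs))
      simp only [h0, if_true]
      exact ⟨by omega, fun _ => hr _ (hp 0 h0) _⟩
    · simp only [h0, if_false, zero_add]
      exact ⟨h1, fun hs => hl _ (h2 hs) _⟩

/-- The weight `|S| - n · 1_S` on an index set with `n` elements; its values add up to zero. -/
def indicatorWeight {ι : Type*} [Fintype ι] [DecidableEq ι] (S : Finset ι) (i : ι) : ℤ :=
  S.card - Fintype.card ι * if i ∈ S then 1 else 0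

theorem sum_indicatorWeight {ι : Type*} [Fintype ι] [DecidableEq ι] (S : Finset ι) :
    ∑ i, indicatorWeight S i = 0 := by
  simp [indicatorWeight, Finset.sum_sub_distrib, mul_comm]

theorem exists_oneParameterSubgroup_of_jacobson_ne_bot {A ι : Type*} [Ring A] [Algebra ℂ A]
    [Fintype ι] [DecidableEq ι] (a : Module.Basis ι ℂ A) {d : ℕ} (hd : 2 < d)
    (hJ : Ring.jacobson A ≠ ⊥) :
    ∃ g : ℂˣ →* SLPow d ι, IsOneParameterSubgroup g ∧
      ∀ x : ι → ℂ, DegeneratesToZero g (algebraTensor d a x) := by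
  have : FiniteDimensional ℂ A := a.finiteDimensional_of_finite
  obtain ⟨K, L, R, hpos, hr, hl, hK, hL, hR, hdim⟩ := exists_square_zero_ideal hJ
  rw [Module.finrank_eq_card_basis a] at hdim
  obtain ⟨c, S, hS, hc⟩ := exists_basis_mem_submodule a K
  obtain ⟨e, rfl⟩ : ∃ e, d = e + 1 := ⟨d - 1, by omega⟩
  -- With at most one penalty $n$, the total weight is at least $|T|+e|S|-n\ge(e-1)|S|>0$. This
  -- needs $e\ge2$, that is $d>2$.
  have count : ∀ (T : Finset ι), Fintype.card ι ≤ S.card + T.card → ∀ (i : ι) (j : Fin e → ι),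
      ((if i ∈ T then 1 else 0) + ∑ k, if j k ∈ S then 1 else 0) ≤ 1 →
      0 < indicatorWeight T i + ∑ k, indicatorWeight S (j k) := by
    intro T hT i j h
    have h' : ((if i ∈ T then 1 else 0) + ∑ k, if j k ∈ S then 1 else 0 : ℤ) ≤ 1 := by
      exact_mod_cast h
    simp only [indicatorWeight, Finset.sum_sub_distrib, ← Finset.mul_sum, Finset.sum_const,
      Finset.card_univ, Fintype.card_fin, nsmul_eq_mul]
    have h1 : (1 : ℤ) ≤ S.card := by exact_mod_cast hS ▸ hpos
    have h2 : (Fintype.card ι : ℤ) ≤ S.card + T.card := by exact_mod_cast hT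
    have h3 : (2 : ℤ) ≤ e := by omega
    have h4 := mul_le_mul_of_nonneg_left h' (Int.natCast_nonneg (Fintype.card ι))
    nlinarith
  -- `L` kills `K` from the left, so the special mode is the first; for `R` it is the last.
  rcases hdim with hdim | hdim
  · obtain ⟨b, T, hT, hb⟩ := exists_basis_mem_submodule a L
    refine exists_oneParameterSubgroup_degeneratesToZero a (fun k => if k = 0 then b else c)
      (fun k => indicatorWeight (if k = 0 then T else S)) (fun k => sum_indicatorWeight _) ?_
    intro j hj
    rw [List.ofFn_succ, List.prod_cons] at hj
    rw [Fin.sum_univ_succ]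
    simp only [if_true, Fin.succ_ne_zero, if_false] at hj ⊢
    obtain ⟨h1, h2⟩ := prod_ofFn_mem_of_square_zero_ideal hr hl hK _ (fun k : Fin e => j k.succ ∈ S)
      (fun k hk => hc _ hk) (right_ne_zero_of_mul hj)
    refine count T (by omega) _ _ ?_
    by_cases h0 : j 0 ∈ T
    · have hs : ¬ 0 < ∑ k : Fin e, if j k.succ ∈ S then 1 else 0 := fun hs =>
        hj (hL _ (hb _ h0) _ (h2 hs))
      simp only [h0, if_true]
      omega
    · simpa only [h0, if_false, zero_add] using h1
  · obtain ⟨b, T, hT, hb⟩ := exists_basis_mem_submodule a R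
    refine exists_oneParameterSubgroup_degeneratesToZero a
      (fun k => if k = Fin.last e then b else c)
      (fun k => indicatorWeight (if k = Fin.last e then T else S))
      (fun k => sum_indicatorWeight _) ?_
    intro j hj
    rw [List.ofFn_succ', List.concat_eq_append, List.prod_append, List.prod_singleton] at hj
    rw [Fin.sum_univ_castSucc, add_comm]
    simp only [if_true, Fin.castSucc_ne_last, if_false] at hj ⊢
    obtain ⟨h1, h2⟩ := prod_ofFn_mem_of_square_zero_ideal hr hl hK _
      (fun k : Fin e => j k.castSucc ∈ S) (fun k hk => hc _ hk) (left_ne_zero_of_mul hj)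
    refine count T (by omega) _ _ ?_
    by_cases h0 : j (Fin.last e) ∈ T
    · have hs : ¬ 0 < ∑ k : Fin e, if j k.castSucc ∈ S then 1 else 0 := fun hs =>
        hj (hR _ (hb _ h0) _ (h2 hs))
      simp only [h0, if_true]
      omega
    · simpa only [h0, if_false, zero_add] using h1

/-! ### Closed paths and traces of matrix powers -/

theorem prod_ofFn_apply {U R : Type*} [Fintype U] [DecidableEq U] [CommRing R] {n : ℕ}
    (B : Fin n → Matrix U U R) (p q : U) :
    (List.ofFn B).prod p q = ∑ u : Fin (n + 1) → U,
      if u 0 = p ∧ u (Fin.last n) = q then ∏ k : Fin n, B k (u k.castSucc) (u k.succ) else 0 := by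
  induction n generalizing p with
  | zero =>
    rw [← (Equiv.funUnique (Fin 1) U).symm.sum_comp]
    simp [Matrix.one_apply, ite_and]
  | succ n ih =>
    rw [List.ofFn_succ, List.prod_cons, Matrix.mul_apply,
      ← (Fin.consEquiv fun _ : Fin (n + 2) => U).sum_comp, Fintype.sum_prod_type]
    simp only [ih, Fin.consEquiv_apply, Fin.cons_zero, Fin.cons_last, Fin.prod_univ_succ,
      Fin.castSucc_zero, ← Fin.succ_castSucc, Fin.cons_succ, Finset.mul_sum, ite_and, mul_ite,
      mul_zero]
    rw [Finset.sum_comm, Finset.sum_comm (γ := U)]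
    simp

theorem trace_prod_ofFn {U R : Type*} [Fintype U] [DecidableEq U] [CommRing R] {n : ℕ}
    (B : Fin (n + 1) → Matrix U U R) :
    (List.ofFn B).prod.trace = ∑ u : Fin (n + 1) → U, ∏ k, B k (u k) (u (k + 1)) := by
  simp only [Matrix.trace, Matrix.diag_apply, prod_ofFn_apply]
  rw [Finset.sum_comm, ← (Fin.snocEquiv fun _ : Fin (n + 2) => U).sum_comp,
    Fintype.sum_prod_type, Finset.sum_comm]
  refine Finset.sum_congr rfl fun u _ => ?_
  -- Appending the starting vertex to the path turns the successor into the cyclic `k + 1` of `Fin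
  -- (n + 1)`.
  have step : ∀ k : Fin (n + 1),
      Fin.snoc (α := fun _ : Fin (n + 2) => U) u (u 0) k.succ = u (k + 1) := by
    intro k
    induction k using Fin.lastCases with
    | last => rw [Fin.succ_last, Fin.snoc_last, Fin.last_add_one]
    | cast i => rw [Fin.succ_castSucc, Fin.snoc_castSucc, Fin.coeSucc_eq_succ]
  have zero : ∀ x, Fin.snoc (α := fun _ : Fin (n + 2) => U) u x 0 = u 0 := fun x => by
    rw [← Fin.castSucc_zero, Fin.snoc_castSucc]
  simp only [Fin.snocEquiv_apply, Fin.snoc_last, Fin.snoc_castSucc, zero, ite_and]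
  simp [step]

section GroupoidTensor
variable {ι U : Type*} [Fintype ι] [DecidableEq ι] [DecidableEq U]

/-- The matrix, indexed by functions `ι → U`, whose entry at `(p, q)` is the sign of the
permutation `σ` with `(p, q) = (s ∘ σ, t ∘ σ)`, and `0` if there is none. -/
noncomputable def signMatrix (s t : ι → U) : Matrix (ι → U) (ι → U) ℂ := fun p q =>
  ∑ σ : Equiv.Perm ι, ((Equiv.Perm.sign σ : ℤ) : ℂ) *
    ∏ i, ((if s (σ i) = p i then 1 else 0) * if t (σ i) = q i then 1 else 0)

/-- Transposition swaps `s` and `t`, which `τ` undoes; the substitution $\sigma\mapsto\tau\sigma$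
costs the sign of `τ`. -/
theorem conjTranspose_signMatrix (s t : ι → U) (τ : Equiv.Perm ι) (hs : ∀ i, s (τ i) = t i)
    (ht : ∀ i, t (τ i) = s i) :
    (signMatrix s t).conjTranspose = ((Equiv.Perm.sign τ : ℤ) : ℂ) • signMatrix s t := by
  ext p q
  rw [Matrix.conjTranspose_apply, Matrix.smul_apply, signMatrix, signMatrix,
    ← Equiv.sum_comp (Equiv.mulLeft τ), smul_eq_mul, Finset.mul_sum, star_sum]
  refine Finset.sum_congr rfl fun σ _ => ?_
  have : star (∏ i, ((if t (σ i) = q i then 1 else 0) * if s (σ i) = p i then (1 : ℂ) else 0)) =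
      ∏ i, ((if s (σ i) = p i then 1 else 0) * if t (σ i) = q i then (1 : ℂ) else 0) := by
    rw [star_prod]
    refine Finset.prod_congr rfl fun i _ => ?_
    split_ifs <;> simp
  simp only [Equiv.coe_mulLeft, Equiv.Perm.mul_apply, hs, ht, star_mul', this]
  simp [mul_assoc]

/-- At the entry `(s, t)` only the identity contributes, since an edge is determined by its
endpoints. -/
theorem signMatrix_ne_zero {s t : ι → U} (h : Function.Injective fun i => (s i, t i)) :
    signMatrix s t ≠ 0 := by
  intro h0
  have h1 := congrFun (congrFun h0 s) t
  rw [signMatrix, Finset.sum_eq_single 1] at h1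
  · simp at h1
  · intro σ _ hσ
    obtain ⟨i, hi⟩ : ∃ i, σ i ≠ i := by
      by_contra! hc
      exact hσ (Equiv.ext hc)
    have : ¬ (s (σ i) = s i ∧ t (σ i) = t i) := fun hc => hi (h (Prod.ext hc.1 hc.2))
    rw [Finset.prod_eq_zero (Finset.mem_univ i), mul_zero]
    simpa [← ite_and] using fun h1 h2 => this ⟨h2, h1⟩
  · simp

open scoped ComplexOrder in
-- $(M^k)^*M^k$ is a scalar multiple of $M^{2k}$, so $M^{2k}=0$ forces $M^k=0$; repeated doubling
-- exceeds any exponent.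
theorem pow_ne_zero_of_conjTranspose_eq_smul {κ : Type*} [Fintype κ] [DecidableEq κ]
    {M : Matrix κ κ ℂ} {z : ℂ} (hM : M.conjTranspose = z • M) (h0 : M ≠ 0) (n : ℕ) :
    M ^ n ≠ 0 := by
  have key : ∀ m, M ^ 2 ^ m ≠ 0 := by
    intro m
    induction m with
    | zero => simpa
    | succ m ih =>
      intro h
      refine ih (Matrix.conjTranspose_mul_self_eq_zero.mp ?_)
      rw [Matrix.conjTranspose_pow, hM, smul_pow, smul_mul_assoc, ← pow_add, ← two_mul,
        ← pow_succ', h, smul_zero]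
  intro h
  exact key n (pow_eq_zero_of_le Nat.lt_two_pow_self.le h)

open scoped ComplexOrder in
-- For $d=2m$, a scalar multiple of the trace is the squared Hilbert–Schmidt norm of $M^m$. The
-- evenness of $d$ enters here.
theorem trace_pow_ne_zero_of_conjTranspose_eq_smul {κ : Type*} [Fintype κ] [DecidableEq κ]
    {M : Matrix κ κ ℂ} {z : ℂ} (hM : M.conjTranspose = z • M) (h0 : M ≠ 0) {d : ℕ}
    (hd : Even d) : (M ^ d).trace ≠ 0 := by
  obtain ⟨m, rfl⟩ := hd
  intro h
  refine pow_ne_zero_of_conjTranspose_eq_smul hM h0 m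
    (Matrix.trace_conjTranspose_mul_self_eq_zero_iff.mp ?_)
  rw [Matrix.conjTranspose_pow, hM, smul_pow, smul_mul_assoc, ← pow_add, Matrix.trace_smul, h,
    smul_zero]

/-- The hyperdeterminant of the tensor of closed paths of length `d` whose edges are indexed by
`ι`, with source `s` and target `t`. -/
theorem hyperdet_closedPaths [Fintype U] {n : ℕ} (s t : ι → U) :
    hyperdet (fun j : Fin (n + 1) → ι => ∑ u : Fin (n + 1) → U,
        ∏ k, ((if s (j k) = u k then 1 else 0) * if t (j k) = u (k + 1) then (1 : ℂ) else 0)) =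
      ((Fintype.card ι).factorial : ℂ)⁻¹ • ((signMatrix s t) ^ (n + 1)).trace := by
  have h := trace_prod_ofFn fun _ : Fin (n + 1) => signMatrix s t
  rw [List.ofFn_const, List.prod_replicate] at h
  rw [h, hyperdet]
  congr 1
  simp only [signMatrix]
  have rhs : ∀ p : Fin (n + 1) → ι → U, ∏ k, ∑ σ : Equiv.Perm ι,
      ((Equiv.Perm.sign σ : ℤ) : ℂ) * ∏ i, ((if s (σ i) = p k i then 1 else 0) *
        if t (σ i) = p (k + 1) i then 1 else 0) = ∑ σ : Fin (n + 1) → Equiv.Perm ι,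
      ∏ k, (((Equiv.Perm.sign (σ k) : ℤ) : ℂ) * ∏ i, ((if s (σ k i) = p k i then 1 else 0) *
        if t (σ k i) = p (k + 1) i then 1 else 0)) := fun p => Fintype.prod_sum _
  simp only [rhs]
  rw [Finset.sum_comm]
  refine Finset.sum_congr rfl fun σ _ => ?_
  rw [Fintype.prod_sum, Finset.mul_sum]
  -- A closed path of length `n + 1` for each element of `ι` is the same as a cyclic sequence of `n
  -- + 1` functions `ι → U`, the indices of `signMatrix`.
  refine Fintype.sum_equiv (Equiv.piComm _) _ _ fun v => ?_
  rw [Finset.prod_mul_distrib (s := Finset.univ (α := Fin (n + 1))), Finset.prod_comm]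
  rfl

end GroupoidTensor

/-! ### Nonvanishing for semisimple algebras -/

theorem blockDiagonal'_single {o : Type*} {n : o → Type*} [DecidableEq o]
    [∀ i, DecidableEq (n i)] {R : Type*} [Semiring R] (x : o) (p q : n x) (r : R) :
    Matrix.blockDiagonal' (Pi.single x (Matrix.single p q r)) =
      Matrix.single (⟨x, p⟩ : (i : o) × n i) ⟨x, q⟩ r := by
  ext ⟨y, p'⟩ ⟨z, q'⟩
  by_cases hyz : y = z
  · subst hyz
    rw [Matrix.blockDiagonal'_apply_eq]
    by_cases hxy : x = y
    · subst hxy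
      simp [Matrix.single_apply]
    · simp [hxy]
  · rw [Matrix.blockDiagonal'_apply_ne _ _ _ hyz, Matrix.single_apply, if_neg]
    rintro ⟨h1, h2⟩
    exact hyz ((congrArg Sigma.fst h1).symm.trans (congrArg Sigma.fst h2))

/-- By Wedderburn's theorem `A` has a basis of matrix units, viewed as edges from row to column. The
block trace of a product of units is 1 if the edges form a closed path and 0 otherwise. Passing to
the basis `a` only multiplies by nonzero determinants. -/
theorem exists_hyperdet_productTensor_ne_zero {A ι : Type*} [Ring A] [Algebra ℂ A] [Fintype ι]
    [DecidableEq ι] [IsSemisimpleRing A] (a : Module.Basis ι ℂ A) {n : ℕ} (hn : Even (n + 1)) :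
    ∃ l : A →ₗ[ℂ] ℂ, hyperdet (productTensor l fun _ : Fin (n + 1) => a) ≠ 0 := by
  have : FiniteDimensional ℂ A := a.finiteDimensional_of_finite
  obtain ⟨m, D, -, ⟨e⟩⟩ := IsSemisimpleRing.exists_algEquiv_pi_matrix_of_isAlgClosed ℂ A
  let units := (Pi.basis fun i => Matrix.stdBasis ℂ (Fin (D i)) (Fin (D i))).map
    e.symm.toLinearEquiv
  let en := units.indexEquiv a
  let c : Module.Basis ι ℂ A := units.reindex en
  let src : (i : Fin m) × (Fin (D i) × Fin (D i)) → (i : Fin m) × Fin (D i) :=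
    fun k => ⟨k.1, k.2.1⟩
  let tgt : (i : Fin m) × (Fin (D i) × Fin (D i)) → (i : Fin m) × Fin (D i) :=
    fun k => ⟨k.1, k.2.2⟩
  let s : ι → (i : Fin m) × Fin (D i) := fun i => src (en.symm i)
  let t : ι → (i : Fin m) × Fin (D i) := fun i => tgt (en.symm i)
  have hs : ∀ k, s (en k) = src k := fun k => congrArg src (en.symm_apply_apply k)
  have ht : ∀ k, t (en k) = tgt k := fun k => congrArg tgt (en.symm_apply_apply k)
  let φ : A →+* Matrix ((i : Fin m) × Fin (D i)) ((i : Fin m) × Fin (D i)) ℂ :=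
    (Matrix.blockDiagonal'RingHom (fun i => Fin (D i)) ℂ).comp (e : A →+* _)
  let l : A →ₗ[ℂ] ℂ :=
    { toFun := fun x => (φ x).trace
      map_add' := fun x y => by rw [map_add, Matrix.trace_add]
      map_smul' := fun z x => by
        change (Matrix.blockDiagonal' (e (z • x))).trace = _
        rw [map_smul, Matrix.blockDiagonal'_smul, Matrix.trace_smul]
        rfl }
  have hφ : ∀ i, φ (c i) = Matrix.single (s i) (t i) 1 := by
    intro i
    obtain ⟨⟨x, p, q⟩, rfl⟩ := en.surjective i
    have hc : e (c (en ⟨x, p, q⟩)) = Pi.single x (Matrix.single p q 1) := by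
      simp [c, units, Matrix.stdBasis_eq_single]
    change Matrix.blockDiagonal' (e (c _)) = _
    rw [hc, blockDiagonal'_single, hs, ht]
  have hst : Function.Injective fun i => (s i, t i) := by
    have inj : Function.Injective fun k => (src k, tgt k) := by
      rintro ⟨x, p, q⟩ ⟨y, p', q'⟩ h
      simp only [src, tgt, Prod.mk.injEq, Sigma.mk.injEq] at h
      obtain ⟨⟨rfl, hp⟩, -, hq⟩ := h
      rw [eq_of_heq hp, eq_of_heq hq]
    exact inj.comp en.symm.injective
  -- Transposition of matrix units, reversing every edge.
  let τ : Equiv.Perm ι :=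
    (en.symm.trans (Equiv.sigmaCongrRight fun i => Equiv.prodComm (Fin (D i)) (Fin (D i)))).trans en
  have hne : hyperdet (productTensor l fun _ : Fin (n + 1) => c) ≠ 0 := by
    have h : productTensor l (fun _ : Fin (n + 1) => c) = fun j : Fin (n + 1) → ι =>
        ∑ u : Fin (n + 1) → (i : Fin m) × Fin (D i), ∏ k,
          ((if s (j k) = u k then 1 else 0) * if t (j k) = u (k + 1) then (1 : ℂ) else 0) := by
      funext j
      change (φ (List.ofFn fun k => c (j k)).prod).trace = _
      rw [map_list_prod, List.map_ofFn, trace_prod_ofFn]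
      simp only [Function.comp_apply, hφ, Matrix.single_apply, ite_and, mul_ite, mul_one, mul_zero]
      refine Finset.sum_congr rfl fun u _ => Finset.prod_congr rfl fun k _ => ?_
      split_ifs <;> rfl
    rw [h, hyperdet_closedPaths]
    refine smul_ne_zero (inv_ne_zero (Nat.cast_ne_zero.mpr (Nat.factorial_ne_zero _))) ?_
    refine trace_pow_ne_zero_of_conjTranspose_eq_smul
      (conjTranspose_signMatrix s t τ (fun i => ?_) fun i => ?_) (signMatrix_ne_zero hst) hn
    · exact hs _
    · exact ht _
  refine ⟨l, ?_⟩
  rw [productTensor_eq_tensorAct_toMatrix l (fun _ => a) fun _ => c, hyperdet_tensorAct]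
  refine mul_ne_zero (Finset.prod_ne_zero_iff.mpr fun _ _ => ?_) hne
  rw [Matrix.det_transpose, ← Module.Basis.det_apply]
  exact (c.isUnit_det a).ne_zero

/-! ### The main theorem -/

theorem theorem1p5 {A : Type*} [Ring A] [Algebra ℂ A] {ι : Type*} [Fintype ι] [DecidableEq ι]
    (a : Module.Basis ι ℂ A) (d : ℕ) (hd : 2 < d) (hd_even : Even d) :
    (hyperdet (genericAlgebraTensor d a) ≠ 0 ↔ IsSemisimpleRing A) ∧
    (Ring.jacobson A ≠ ⊥ ↔ hyperdet (genericAlgebraTensor d a) = 0) ∧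
    (Ring.jacobson A ≠ ⊥ →
      (∃ g : ℂˣ →* SLPow d ι, IsOneParameterSubgroup g ∧
        ∀ x : ι → ℂ, DegeneratesToZero g (algebraTensor d a x)) ∧
      (∀ x : ι → ℂ, (0 : Hypermatrix d ι ℂ) ∈ closure (slOrbit (algebraTensor d a x))) ∧
      (∀ x : ι → ℂ, algebraTensor d a x ∈ nullCone d ι)) := by
  have : FiniteDimensional ℂ A := a.finiteDimensional_of_finite
  have : IsArtinianRing A := IsArtinianRing.of_finite ℂ A
  have closure : Ring.jacobson A ≠ ⊥ → ∀ x : ι → ℂ,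
      (0 : Hypermatrix d ι ℂ) ∈ closure (slOrbit (algebraTensor d a x)) := fun hJ x => by
    obtain ⟨g, -, hg⟩ := exists_oneParameterSubgroup_of_jacobson_ne_bot a hd hJ
    exact (hg x).zero_mem_closure_slOrbit
  have main : Ring.jacobson A ≠ ⊥ ↔ hyperdet (genericAlgebraTensor d a) = 0 := by
    rw [hyperdet_genericAlgebraTensor_eq_zero_iff]
    constructor
    · intro hJ x
      -- An empty basis means $A=0$, whose radical is trivial.
      have : Nonempty ι := by
        by_contra hι
        rw [not_nonempty_iff] at hι
        have : Subsingleton A := a.repr.toEquiv.subsingleton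
        exact hJ (Subsingleton.elim _ _)
      exact hyperdet_eq_zero_of_zero_mem_closure_slOrbit (closure hJ x)
    · intro h hJ
      have : IsSemisimpleRing A := IsArtinianRing.isSemisimpleRing_iff_jacobson.mpr hJ
      obtain ⟨n, rfl⟩ : ∃ n, d = n + 1 := ⟨d - 1, by omega⟩
      obtain ⟨l, hl⟩ := exists_hyperdet_productTensor_ne_zero a hd_even
      refine hl ?_
      -- Taking for `x` the values of `l` on the basis makes $C^A(x)$ the product tensor of `l`.
      have := h fun i => l (a i)
      rwa [algebraTensor_eq_productTensor, show a.constr ℂ (fun i => l (a i)) = l from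
        a.ext fun i => a.constr_basis ℂ _ i] at this
  refine ⟨?_, main, fun hJ => ⟨exists_oneParameterSubgroup_of_jacobson_ne_bot a hd hJ,
    closure hJ, fun x => mem_nullCone_of_zero_mem_closure_slOrbit (closure hJ x)⟩⟩
  rw [IsArtinianRing.isSemisimpleRing_iff_jacobson, Ne, ← main, not_not]
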